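/- All groups are finite. For a finite group $G$ let $\mathrm H^2(G,\mathbb C^\times)$ be the second cohomology group with trivial action, and for a $2$-cocycle $\alpha\in Z^2(G,\mathbb C^\times)$ let $\mathbb C^\alpha G$ be the twisted group algebra with $\mathbb C$-basis $\{\bar g : g\in G\}$ and multiplication $\bar g\,\bar h=\alpha(g,h)\,\overline{gh}$. Write $G\sim_{\mathbb C}H$ if there is a group isomorphism $\phi:\mathrm H^2(G,\mathbb C^\times)\to \mathrm H^2(H,\mathbb C^\times)$ such that $\mathbb C^\alpha G\cong\mathbb C^{\beta}H$ as $\mathbb C$-algebras for all cocycles $\alpha,\beta$ with $\phi([\alpha])=[\beta]$. For a central subgroup $Z$ of $G$ and a section $\mu$ of $G\to G/Z$, let $\mathrm{tra}:\mathrm{Hom}(Z,\mathbb C^\times)\to \mathrm H^2(G/Z,\mathbb C^\times)$ send $\chi$ to the class of $(x,y)\mapsto\chi(\mu(x)\mu(y)\mu(xy)^{-1})$ (this does not depend on $\mu$), and let $\inf:\mathrm H^2(G/Z,\mathbb C^\times)\to \mathrm H^2(G,\mathbb C^\times)$ be inflation. Say that a pair $(G,H)$ satisfies condition $(\ast)$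 if there are central subgroups $Z\le G$ and $W\le H$ such that the sequences $$1\to \mathrm{Hom}(Z,\mathbb C^\times)\xrightarrow{\mathrm{tra}}\mathrm H^2(G/Z,\mathbb C^\times)\xrightarrow{\inf}\mathrm H^2(G,\mathbb C^\times)\to1,$$ $$1\to \mathrm{Hom}(W,\mathbb C^\times)\xrightarrow{\mathrm{tra}}\mathrm H^2(H/W,\mathbb C^\times)\xrightarrow{\inf}\mathrm H^2(H,\mathbb C^\times)\to1$$ are exact, and there are isomorphisms $i:W\to Z$ and $\phi:H/W\to G/Z$ such that the induced maps $\bar i:\mathrm{Hom}(Z,\mathbb C^\times)\to\mathrm{Hom}(W,\mathbb C^\times)$, $\chi\mapsto\chi\circ i$, and $\bar\phi:\mathrm H^2(G/Z,\mathbb C^\times)\to\mathrm H^2(H/W,\mathbb C^\times)$, $[\alpha]\mapsto[\alpha\circ(\phi\times\phi)]$, satisfy $\bar\phi\circ\mathrm{tra}=\mathrm{tra}\circ\bar i$. **Corollary 1.4.** Suppose that the pairs $(G_1,H_1)$ and $(G_2,H_2)$ both satisfy condition $(\ast)$. Then: (i) $G_1\times G_2\sim_{\mathbb C}H_1\times H_2$;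 (ii) $G_1\times A\sim_{\mathbb C}H_1\times A$ for every finite abelian group $A$. -/

import Mathlib

/-! Second cohomology with trivial coefficients (in multiplicative notation), twisted group
algebras, inflation, transgression, and the relation `∼_R` between groups. -/

namespace TwistedGroupRing

section Cohomology

variable (G : Type*) [Group G] (M : Type*) [CommGroup M]

/-- `Z²(G, M)`: the 2-cocycles of `G` with values in the trivial `G`-module `M`. They are not
required to be normalized. -/
def cocycles : Subgroup (G → G → M) where
  carrier := {α | ∀ x y z, α x y * α (x * y) z = α y z * α x (y * z)}
  one_mem' := by intro x y z; simp
  mul_mem' := by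
    intro α β hα hβ x y z
    simp only [Pi.mul_apply]
    rw [mul_mul_mul_comm, hα x y z, hβ x y z, mul_mul_mul_comm]
  inv_mem' := by
    intro α hα x y z
    simp only [Pi.inv_apply]
    rw [← mul_inv, ← mul_inv, hα x y z]

variable {G M} in
lemma cocycles_condition (α : cocycles G M) (x y z : G) :
    α.1 x y * α.1 (x * y) z = α.1 y z * α.1 x (y * z) := α.2 x y z

/-- The coboundary map, `f ↦ ((x, y) ↦ f x * f y * (f (x * y))⁻¹)`. -/
def coboundaryMap : (G → M) →* cocycles G M where
  toFun f := ⟨fun x y => f x * f y * (f (x * y))⁻¹, by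
    intro x y z
    beta_reduce
    rw [← div_eq_mul_inv, ← div_eq_mul_inv, ← div_eq_mul_inv, ← div_eq_mul_inv,
      div_mul_div_comm, div_mul_div_comm, div_eq_div_iff_mul_eq_mul, mul_assoc x y z]
    simp only [mul_comm, mul_left_comm]⟩
  map_one' := by ext x y; simp
  map_mul' f g := by
    ext x y
    simp only [Pi.mul_apply, Subgroup.coe_mul, mul_inv]
    ac_rfl

/-- `H²(G, M)` for the trivial `G`-module `M`: cocycles modulo coboundaries. -/
abbrev H2 : Type _ := cocycles G M ⧸ (coboundaryMap G M).range

variable {G} {K : Type*} [Group K]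

/-- Pullback of cocycles along `f : K → G`, `α ↦ ((x, y) ↦ α (f x) (f y))`. -/
def cocyclesComap (f : K →* G) : cocycles G M →* cocycles K M where
  toFun α := ⟨fun x y => α.1 (f x) (f y), by
    intro x y z
    simpa using cocycles_condition α (f x) (f y) (f z)⟩
  map_one' := rfl
  map_mul' _ _ := rfl

/-- The homomorphism `H²(G, M) → H²(K, M)` induced by `f : K → G`. -/
def H2Comap (f : K →* G) : H2 G M →* H2 K M :=
  QuotientGroup.map _ _ (cocyclesComap M f) <| by
    rintro _ ⟨c, rfl⟩
    exact ⟨c ∘ f, by ext x y; simp [coboundaryMap, cocyclesComap]⟩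

/-- The inflation map `H²(G/Z, M) → H²(G, M)`, `[α] ↦ [(x, y) ↦ α (xZ) (yZ)]`. -/
def inflation (Z : Subgroup G) [Z.Normal] : H2 (G ⧸ Z) M →* H2 G M :=
  H2Comap M (QuotientGroup.mk' Z)

end Cohomology

section Transgression

variable {G : Type*} [Group G] {Z : Subgroup G} [Z.Normal] {M : Type*} [CommGroup M]

/-- For a section `μ` of `G → G/Z`, the element `μ(x) μ(y) μ(xy)⁻¹` of `Z`. -/
def factorSet (μ : G ⧸ Z → G) (hμ : ∀ q, (μ q : G ⧸ Z) = q) (x y : G ⧸ Z) : Z :=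
  ⟨μ x * μ y * (μ (x * y))⁻¹, by
    rw [← QuotientGroup.eq_one_iff]
    simp [hμ]⟩

/-- For `Z` central, a section `μ` of `G → G/Z` and `χ ∈ Hom(Z, M)`, the 2-cocycle
`(x, y) ↦ χ(μ(x) μ(y) μ(xy)⁻¹)` of `G/Z`. -/
def transgressionCocycle (hZ : Z ≤ Subgroup.center G) (μ : G ⧸ Z → G)
    (hμ : ∀ q, (μ q : G ⧸ Z) = q) : (Z →* M) →* cocycles (G ⧸ Z) M where
  toFun χ := ⟨fun x y => χ (factorSet μ hμ x y), by
    intro x y z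
    simp only [← map_mul]
    congr 1
    ext
    have hc := Subgroup.mem_center_iff.1 (hZ (factorSet μ hμ y z).2) (μ x)
    simp only [factorSet, Subgroup.coe_mul, mul_assoc x y z] at hc ⊢
    rw [← mul_assoc (μ y * μ z * (μ (y * z))⁻¹), ← mul_assoc (μ y * μ z * (μ (y * z))⁻¹), ← hc]
    group⟩
  map_one' := rfl
  map_mul' _ _ := rfl

/-- The class of the transgression cocycle does not depend on the section. -/
lemma transgressionCocycle_mk_eq (hZ : Z ≤ Subgroup.center G) (μ ν : G ⧸ Z → G)
    (hμ : ∀ q, (μ q : G ⧸ Z) = q) (hν : ∀ q, (ν q : G ⧸ Z) = q) (χ : Z →* M) :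
    (transgressionCocycle hZ μ hμ χ : H2 (G ⧸ Z) M) = transgressionCocycle hZ ν hν χ := by
  have hd : ∀ q, ν q * (μ q)⁻¹ ∈ Z := fun q => by
    rw [← QuotientGroup.eq_one_iff]; simp [hμ, hν]
  rw [QuotientGroup.eq]
  refine ⟨fun q => χ ⟨ν q * (μ q)⁻¹, hd q⟩, ?_⟩
  ext x y
  simp only [coboundaryMap, transgressionCocycle, MonoidHom.coe_mk, OneHom.coe_mk,
    Subgroup.coe_mul, Subgroup.coe_inv, Pi.mul_apply, Pi.inv_apply, ← map_mul, ← map_inv]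
  congr 1
  ext
  have h1 := Subgroup.mem_center_iff.1 (hZ (hd x))
  have h2 := Subgroup.mem_center_iff.1 (hZ (hd y))
  have h3 := Subgroup.mem_center_iff.1 (hZ (hd (x * y)))
  simp only [factorSet, Subgroup.coe_mul, Subgroup.coe_inv]
  obtain ⟨a, ha⟩ : ∃ a, a = ν x * (μ x)⁻¹ := ⟨_, rfl⟩
  obtain ⟨b, hb⟩ : ∃ b, b = ν y * (μ y)⁻¹ := ⟨_, rfl⟩
  obtain ⟨c, hc⟩ : ∃ c, c = ν (x * y) * (μ (x * y))⁻¹ := ⟨_, rfl⟩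
  rw [← ha] at h1 ⊢
  rw [← hb] at h2 ⊢
  rw [← hc] at h3 ⊢
  have ex : ν x = a * μ x := by rw [ha]; group
  have ey : ν y = b * μ y := by rw [hb]; group
  have ez : ν (x * y) = c * μ (x * y) := by rw [hc]; group
  have h3' : ∀ g, g * c⁻¹ = c⁻¹ * g := fun g => by
    rw [mul_inv_eq_iff_eq_mul, mul_assoc, h3, inv_mul_cancel_left]
  rw [ex, ey, ez, mul_inv_rev (c) , h3']
  rw [show a * μ x * (b * μ y) = a * b * (μ x * μ y) by
    rw [mul_assoc, ← mul_assoc (μ x), h2 (μ x)]; simp only [mul_assoc]]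
  rw [show a * b * (μ x * μ y) * ((μ (x * y))⁻¹ * c⁻¹) =
    a * b * (μ x * μ y * (μ (x * y))⁻¹) * c⁻¹ by simp only [mul_assoc]]
  rw [show ∀ d : G, a * b * d = d * (a * b) from fun d => by
    rw [mul_assoc, ← h2 d, ← mul_assoc, ← h1 d, mul_assoc]]
  rw [mul_assoc (μ x * μ y * (μ (x * y))⁻¹), inv_mul_cancel_left, h3']

variable (M) in
/-- The transgression map `Hom(Z, M) → H²(G/Z, M)` of the central extension
`1 → Z → G → G/Z → 1`, computed with one choice of section. -/
noncomputable def transgression (hZ : Z ≤ Subgroup.center G) : (Z →* M) →* H2 (G ⧸ Z) M :=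
  (QuotientGroup.mk' _).comp (transgressionCocycle hZ Quotient.out Quotient.out_eq')

end Transgression

section Algebra

variable {G : Type*} [Group G] {R : Type*} [CommRing R]

/-- The twisted group ring `R^α G`, a free `R`-module on the symbols `ḡ`, `g ∈ G`. -/
def TwistedGroupAlgebra (_α : cocycles G Rˣ) : Type _ := G →₀ R

namespace TwistedGroupAlgebra

variable (α : cocycles G Rˣ)

noncomputable instance : AddCommGroup (TwistedGroupAlgebra α) :=
  inferInstanceAs (AddCommGroup (G →₀ R))

noncomputable instance : Module R (TwistedGroupAlgebra α) :=
  inferInstanceAs (Module R (G →₀ R))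

/-- The element `r ḡ`. -/
noncomputable def single (g : G) (r : R) : TwistedGroupAlgebra α := Finsupp.single g r

/-- The `R`-bilinear multiplication with `ḡ h̄ = α(g, h) \overline{gh}`. -/
noncomputable def mulBilin : (G →₀ R) →ₗ[R] (G →₀ R) →ₗ[R] (G →₀ R) :=
  Finsupp.lift _ R G fun g => Finsupp.lift _ R G fun h =>
    Finsupp.single (g * h) (α.1 g h : R)

lemma mulBilin_single (g h : G) (r s : R) :
    mulBilin α (Finsupp.single g r) (Finsupp.single h s) =
      Finsupp.single (g * h) (r * s * (α.1 g h : R)) := by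
  rw [mulBilin, Finsupp.lift_apply, Finsupp.sum_single_index, LinearMap.smul_apply,
    Finsupp.lift_apply, Finsupp.sum_single_index, Finsupp.smul_single, Finsupp.smul_single,
    smul_eq_mul, smul_eq_mul, mul_assoc]
  all_goals exact zero_smul _ _

noncomputable instance : Mul (TwistedGroupAlgebra α) := ⟨fun a b => mulBilin α a b⟩

/-- The identity is `α(1, 1)⁻¹ 1̄`. -/
noncomputable instance : One (TwistedGroupAlgebra α) :=
  ⟨single α 1 ((α.1 1 1)⁻¹ : Rˣ)⟩

lemma mul_def (a b : TwistedGroupAlgebra α) : a * b = mulBilin α a b := rfl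

lemma one_def : (1 : TwistedGroupAlgebra α) = single α 1 ((α.1 1 1)⁻¹ : Rˣ) := rfl

lemma single_mul_single (g h : G) (r s : R) :
    single α g r * single α h s = single α (g * h) (r * s * (α.1 g h : R)) :=
  mulBilin_single α g h r s

@[elab_as_elim]
lemma induction {p : TwistedGroupAlgebra α → Prop} (a : TwistedGroupAlgebra α) (zero : p 0)
    (add : ∀ a b, p a → p b → p (a + b)) (single : ∀ g r, p (single α g r)) : p a :=
  Finsupp.induction_linear a zero add single

protected lemma add_mul (a b c : TwistedGroupAlgebra α) : (a + b) * c = a * c + b * c :=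
  LinearMap.map_add₂ (mulBilin α) a b c

protected lemma mul_add (a b c : TwistedGroupAlgebra α) : a * (b + c) = a * b + a * c :=
  map_add (mulBilin α a) b c

protected lemma zero_mul (a : TwistedGroupAlgebra α) : 0 * a = 0 :=
  LinearMap.map_zero₂ (mulBilin α) a

protected lemma mul_zero (a : TwistedGroupAlgebra α) : a * 0 = 0 :=
  map_zero (mulBilin α a)

protected lemma one_mul (a : TwistedGroupAlgebra α) : 1 * a = a := by
  induction a using induction with
  | zero => exact TwistedGroupAlgebra.mul_zero α 1
  | add a b ha hb => rw [TwistedGroupAlgebra.mul_add, ha, hb]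
  | single g r =>
    have h : α.1 1 g = α.1 1 1 := by
      have := cocycles_condition α 1 1 g
      simpa using this.symm
    rw [one_def, single_mul_single, one_mul, h, mul_right_comm, Units.inv_mul, one_mul]

protected lemma mul_one (a : TwistedGroupAlgebra α) : a * 1 = a := by
  induction a using induction with
  | zero => exact TwistedGroupAlgebra.zero_mul α 1
  | add a b ha hb => rw [TwistedGroupAlgebra.add_mul, ha, hb]
  | single g r =>
    have h : α.1 g 1 = α.1 1 1 := by
      have := cocycles_condition α g 1 1
      simpa using this
    rw [one_def, single_mul_single, mul_one, h, mul_assoc, Units.inv_mul, mul_one]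

protected lemma mul_assoc (a b c : TwistedGroupAlgebra α) : a * b * c = a * (b * c) := by
  induction a using induction with
  | zero => simp only [TwistedGroupAlgebra.zero_mul]
  | add a a' h h' => simp only [TwistedGroupAlgebra.add_mul, h, h']
  | single x r =>
    induction b using induction with
    | zero => simp only [TwistedGroupAlgebra.zero_mul, TwistedGroupAlgebra.mul_zero]
    | add b b' h h' => simp only [TwistedGroupAlgebra.add_mul, TwistedGroupAlgebra.mul_add, h, h']
    | single y s =>
      induction c using induction with
      | zero => simp only [TwistedGroupAlgebra.mul_zero]
      | add c c' h h' => simp only [TwistedGroupAlgebra.mul_add, h, h']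
      | single z t =>
        have h := congrArg (Units.val : Rˣ → R) (cocycles_condition α x y z)
        simp only [Units.val_mul] at h
        simp only [single_mul_single, mul_assoc x y z]
        congr 1
        linear_combination (r * s * t) * h

noncomputable instance : Ring (TwistedGroupAlgebra α) where
  __ : AddCommGroup (TwistedGroupAlgebra α) := inferInstance
  left_distrib := TwistedGroupAlgebra.mul_add α
  right_distrib := TwistedGroupAlgebra.add_mul α
  zero_mul := TwistedGroupAlgebra.zero_mul α
  mul_zero := TwistedGroupAlgebra.mul_zero α
  mul_assoc := TwistedGroupAlgebra.mul_assoc α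
  one_mul := TwistedGroupAlgebra.one_mul α
  mul_one := TwistedGroupAlgebra.mul_one α

noncomputable instance : Algebra R (TwistedGroupAlgebra α) :=
  Algebra.ofModule
    (fun r a b => LinearMap.map_smul₂ (mulBilin α) r a b)
    (fun r a b => map_smul (mulBilin α a) r b)

end TwistedGroupAlgebra

end Algebra

/-- `G ∼_R H`: there is an isomorphism `φ : H²(G, Rˣ) → H²(H, Rˣ)` such that `R^α G` and `R^β H`
are isomorphic `R`-algebras whenever `φ[α] = [β]`. -/
def TwistedEquiv (R : Type*) [CommRing R] (G H : Type*) [Group G] [Group H] : Prop :=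
  ∃ φ : H2 G Rˣ ≃* H2 H Rˣ, ∀ (α : cocycles G Rˣ) (β : cocycles H Rˣ),
    φ (α : H2 G Rˣ) = (β : H2 H Rˣ) →
      Nonempty (TwistedGroupAlgebra α ≃ₐ[R] TwistedGroupAlgebra β)

/-- Exactness of `1 → Hom(Z, ℂˣ) → H²(G/Z, ℂˣ) → H²(G, ℂˣ) → 1` (transgression, then inflation)
for a central subgroup `Z` of `G`. -/
def TransgressionInflationExact {G : Type*} [Group G] (Z : Subgroup G) [Z.Normal]
    (hZ : Z ≤ Subgroup.center G) : Prop :=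
  Function.Injective (transgression ℂˣ hZ) ∧
    (transgression ℂˣ hZ).range = (inflation ℂˣ Z).ker ∧
    Function.Surjective (inflation ℂˣ Z)

/-- There are central subgroups `Z ≤ G` and `W ≤ H` with exact transgression-inflation sequences
and isomorphisms `i : W → Z`, `φ : H/W → G/Z` such that the square formed by the two transgression
maps and the maps `Hom(Z, ℂˣ) → Hom(W, ℂˣ)`, `H²(G/Z, ℂˣ) → H²(H/W, ℂˣ)` induced by `i` and `φ`
commutes. -/
def CompatibleCentralQuotients (G H : Type*) [Group G] [Group H] : Prop :=
  ∃ (Z : Subgroup G) (W : Subgroup H) (_ : Z.Normal) (_ : W.Normal)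
    (hZ : Z ≤ Subgroup.center G) (hW : W ≤ Subgroup.center H),
    TransgressionInflationExact Z hZ ∧ TransgressionInflationExact W hW ∧
    ∃ (i : W ≃* Z) (φ : H ⧸ W ≃* G ⧸ Z), ∀ χ : Z →* ℂˣ,
      H2Comap ℂˣ φ.toMonoidHom (transgression ℂˣ hZ χ) =
        transgression ℂˣ hW (χ.comp i.toMonoidHom)

end TwistedGroupRing

namespace TwistedGroupRing

/-! Let `1 → A → G → Q → 1` be a central extension of finite groups and `γ` a cocycle of `Q`.
Splitting by characters of `A` gives `ℂ^{inf γ} G ≅ ∏_χ ℂ^{γ · tra χ} Q`, with `χ` running over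
`Hom(A, ℂˣ)` (`nonempty_algEquiv_pi`). The right side sees only `Q`, `A`, `γ` and the classes `tra
χ`. The kernel of inflation is always the image of transgression. So if two extensions of `Q` by `A`
have equal transgressions and surjective inflations, both second cohomology groups are `H²(Q, ℂˣ)`
modulo the same subgroup, and corresponding algebras agree factor by factor (`twistedEquiv`).

It remains to pass to products. Transgression is computed componentwise. For inflation, a class of
`G₁ × G₂` is the product of its restrictions and a bimultiplicative pairing `G₁ × G₂ → ℂˣ`
(`mk_eq_mul_pairing`). The restrictions are inflated by hypothesis. The pairing descends to `Q₁ ×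
Q₂` because injectivity of transgression forces every character of `Gᵢ` to be trivial on `Aᵢ`: the
restriction to `Aᵢ` of a character of `Gᵢ` transgresses to the trivial class. Part (ii) takes the
extension of `A` with trivial kernel as second factor. -/

lemma H2Comap_mk {G K M : Type*} [Group G] [Group K] [CommGroup M] (f : K →* G)
    (α : cocycles G M) :
    H2Comap M f (α : H2 G M) = (cocyclesComap M f α : H2 K M) := rfl

lemma H2Comap_comp {G K L M : Type*} [Group G] [Group K] [Group L] [CommGroup M]
    (f : K →* G) (g : L →* K) (x : H2 G M) :
    H2Comap M g (H2Comap M f x) = H2Comap M (f.comp g) x := by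
  induction x using QuotientGroup.induction_on with
  | H α => rfl

lemma H2Comap_id {G M : Type*} [Group G] [CommGroup M] (x : H2 G M) :
    H2Comap M (MonoidHom.id G) x = x := by
  induction x using QuotientGroup.induction_on with
  | H α => rfl

lemma H2_mk_eq_iff {G M : Type*} [Group G] [CommGroup M] {α β : cocycles G M} :
    (α : H2 G M) = β ↔
      ∃ f : G → M, ∀ x y, f x * f y * α.1 x y = f (x * y) * β.1 x y := by
  rw [QuotientGroup.eq]
  constructor
  · rintro ⟨f, hf⟩
    refine ⟨f, fun x y => ?_⟩
    have h : f x * f y * (f (x * y))⁻¹ = (α.1 x y)⁻¹ * β.1 x y :=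
      congrFun (congrFun (congrArg Subtype.val hf) x) y
    rw [mul_inv_eq_iff_eq_mul] at h
    rw [h, mul_right_comm, inv_mul_cancel_comm, mul_comm]
  · rintro ⟨f, hf⟩
    refine ⟨f, ?_⟩
    ext x y
    change f x * f y * (f (x * y))⁻¹ = (α.1 x y)⁻¹ * β.1 x y
    rw [mul_inv_eq_iff_eq_mul, eq_comm, ← mul_left_inj (α.1 x y), hf]
    rw [mul_right_comm, inv_mul_cancel_comm, mul_comm]

lemma H2_mk_eq_one_iff {G M : Type*} [Group G] [CommGroup M] {α : cocycles G M} :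
    (α : H2 G M) = 1 ↔ ∃ f : G → M, ∀ x y, f x * f y = f (x * y) * α.1 x y := by
  rw [eq_comm, ← QuotientGroup.mk_one, H2_mk_eq_iff]
  simp

/-! Homomorphisms out of twisted group algebras. -/

namespace TwistedGroupAlgebra

variable {G R B : Type*} [Group G] [CommRing R] [Ring B] [Algebra R B]

/-- The algebra homomorphism `ḡ ↦ u g` for a map `u` with
`u g * u h = α (g, h) • u (g * h)`. -/
noncomputable def lift (α : cocycles G Rˣ) (u : G → B) (h1 : u 1 = (α.1 1 1 : R) • (1 : B))
    (hu : ∀ g h, u g * u h = (α.1 g h : R) • u (g * h)) :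
    TwistedGroupAlgebra α →ₐ[R] B :=
  AlgHom.ofLinearMap (Finsupp.linearCombination R u :
      (G →₀ R) →ₗ[R] B)
    (by
      change Finsupp.linearCombination R u (Finsupp.single 1 _) = 1
      rw [Finsupp.linearCombination_single, h1, smul_smul, Units.inv_mul, one_smul])
    (by
      intro a b
      have key : (LinearMap.compr₂ (mulBilin α) (Finsupp.linearCombination R u)) =
          (LinearMap.mul R B).compl₁₂ (Finsupp.linearCombination R u)
            (Finsupp.linearCombination R u) := by
        ext g h
        simp [mulBilin_single, hu]
      exact LinearMap.congr_fun₂ key a b)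

lemma lift_single (α : cocycles G Rˣ) (u : G → B) (h1 : u 1 = (α.1 1 1 : R) • (1 : B))
    (hu : ∀ g h, u g * u h = (α.1 g h : R) • u (g * h)) (g : G) (r : R) :
    lift α u h1 hu (single α g r) = r • u g :=
  Finsupp.linearCombination_single R r g

lemma algHom_ext {α : cocycles G Rˣ} {f f' : TwistedGroupAlgebra α →ₐ[R] B}
    (h : ∀ g r, f (single α g r) = f' (single α g r)) : f = f' := by
  ext a
  induction a using induction with
  | zero => simp
  | add a b ha hb => rw [map_add, map_add, ha, hb]
  | single g r => exact h g r

lemma smul_single (α : cocycles G Rˣ) (g : G) (r s : R) :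
    r • single α g s = single α g (r * s) := Finsupp.smul_single r g s

/-- The algebra homomorphism `ḡ ↦ f g • ḡ` between twisted group algebras of cohomologous
cocycles. -/
noncomputable def rescale {α β : cocycles G Rˣ} (f : G → Rˣ)
    (h : ∀ x y, f x * f y * β.1 x y = f (x * y) * α.1 x y) :
    TwistedGroupAlgebra α →ₐ[R] TwistedGroupAlgebra β :=
  lift α (fun g => single β g (f g))
    (by
      have := h 1 1
      rw [mul_one, mul_assoc, mul_right_inj] at this
      rw [one_def, smul_single, ← Units.val_mul, ← this, mul_inv_cancel_right])
    (by
      intro x y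
      rw [single_mul_single, smul_single, ← Units.val_mul, ← Units.val_mul, ← Units.val_mul,
        h, mul_comm])

lemma rescale_single {α β : cocycles G Rˣ} (f : G → Rˣ)
    (h : ∀ x y, f x * f y * β.1 x y = f (x * y) * α.1 x y) (g : G) (r : R) :
    rescale f h (single α g r) = single β g (r * f g) := by
  rw [rescale, lift_single, smul_single]

/-- Cohomologous cocycles have isomorphic twisted group algebras. -/
lemma nonempty_algEquiv_of_mk_eq {α β : cocycles G Rˣ} (h : (α : H2 G Rˣ) = β) :
    Nonempty (TwistedGroupAlgebra α ≃ₐ[R] TwistedGroupAlgebra β) := by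
  obtain ⟨f, hf⟩ := H2_mk_eq_iff.1 h
  have hf' : ∀ x y, f⁻¹ x * f⁻¹ y * β.1 x y = f⁻¹ (x * y) * α.1 x y := fun x y => by
    simp only [Pi.inv_apply]
    rw [eq_inv_mul_iff_mul_eq, mul_left_comm, ← hf, ← mul_inv, inv_mul_cancel_left]
  refine ⟨AlgEquiv.ofAlgHom (rescale f⁻¹ hf') (rescale f hf) ?_ ?_⟩
  all_goals
    refine algHom_ext fun g r => ?_
    rw [AlgHom.comp_apply, rescale_single, rescale_single]
    simp [mul_assoc]

end TwistedGroupAlgebra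

/-! ### Central extensions: coordinates, factor sets, transgression and inflation -/

/-- A central extension `1 → A → G → Q → 1` with a chosen section. -/
structure CentralExtension (A Q G : Type*) [CommGroup A] [Group Q] [Group G] where
  ι : A →* G
  π : G →* Q
  sec : Q → G
  ι_injective : Function.Injective ι
  π_ι : ∀ a, π (ι a) = 1
  exists_ι_eq : ∀ g, π g = 1 → ∃ a, ι a = g
  central : ∀ a g, ι a * g = g * ι a
  π_sec : ∀ q, π (sec q) = q

namespace CentralExtension

section Basic

variable {A Q G M : Type*} [CommGroup A] [Group Q] [Group G] [CommGroup M]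
  (E : CentralExtension A Q G)

lemma exists_coord (g : G) : ∃ a, E.ι a = g * (E.sec (E.π g))⁻¹ :=
  E.exists_ι_eq _ (by simp [E.π_sec])

/-- The `A`-component of `g`, so that `g = ι (coord g) * sec (π g)`. -/
noncomputable def coord (g : G) : A := (E.exists_coord g).choose

lemma ι_coord_mul (g : G) : E.ι (E.coord g) * E.sec (E.π g) = g := by
  rw [coord, (E.exists_coord g).choose_spec, inv_mul_cancel_right]

lemma coord_eq {g : G} {a : A} (h : E.ι a * E.sec (E.π g) = g) : E.coord g = a :=
  E.ι_injective (mul_right_cancel ((E.ι_coord_mul g).trans h.symm))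

lemma coord_ι_mul (a : A) (g : G) : E.coord (E.ι a * g) = a * E.coord g := by
  apply E.coord_eq
  rw [map_mul, map_mul, E.π_ι, one_mul, mul_assoc, E.ι_coord_mul]

lemma coord_sec (q : Q) : E.coord (E.sec q) = 1 := by
  apply E.coord_eq
  rw [E.π_sec, map_one, one_mul]

/-- Centrality collects the kernel parts of `g` and `h` in front; what is left is the product of two
section values, which contributes the factor set. -/
lemma coord_mul (g h : G) :
    E.coord (g * h) = E.coord g * E.coord h * E.coord (E.sec (E.π g) * E.sec (E.π h)) := by
  rw [← coord_ι_mul, map_mul]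
  congr 1
  nth_rw 1 [← E.ι_coord_mul g, ← E.ι_coord_mul h]
  rw [mul_assoc, mul_assoc, ← mul_assoc (E.sec _), ← E.central, mul_assoc]

/-- The factor set of the section. -/
noncomputable def factorCocycle : cocycles Q A :=
  ⟨fun x y => E.coord (E.sec x * E.sec y), by
    intro x y z
    -- The cocycle identity is associativity: the coordinate of `sec x * sec y * sec z` is computed
    -- with both bracketings.
    have h1 := E.coord_mul (E.sec x * E.sec y) (E.sec z)
    have h2 := E.coord_mul (E.sec x) (E.sec y * E.sec z)
    simp only [map_mul, E.π_sec, E.coord_sec, mul_one, one_mul] at h1 h2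
    rw [← h1, ← h2, mul_assoc]⟩

lemma factorCocycle_apply (x y : Q) :
    E.factorCocycle.1 x y = E.coord (E.sec x * E.sec y) := rfl

lemma ι_factorCocycle (x y : Q) :
    E.ι (E.factorCocycle.1 x y) = E.sec x * E.sec y * (E.sec (x * y))⁻¹ := by
  have := E.ι_coord_mul (E.sec x * E.sec y)
  rw [map_mul, E.π_sec, E.π_sec] at this
  rw [factorCocycle_apply, eq_mul_inv_iff_mul_eq, this]

/-- The transgression cocycle attached to a character of the kernel. -/
noncomputable def traCocycle (χ : A →* M) : cocycles Q M :=
  ⟨fun x y => χ (E.factorCocycle.1 x y), by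
    intro x y z
    simp only [← map_mul, cocycles_condition E.factorCocycle]⟩

lemma traCocycle_apply (χ : A →* M) (x y : Q) :
    (E.traCocycle χ).1 x y = χ (E.factorCocycle.1 x y) := rfl

/-- Exactness of the transgression-inflation sequence in the middle. -/
lemma mem_ker_inflation_iff (x : H2 Q M) :
    x ∈ (H2Comap M E.π).ker ↔ ∃ χ : A →* M, x = (E.traCocycle χ : H2 Q M) := by
  rw [MonoidHom.mem_ker]
  constructor
  · induction x using QuotientGroup.induction_on with | H β => ?_
    rw [H2Comap_mk, H2_mk_eq_one_iff]
    rintro ⟨f, hf⟩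
    replace hf : ∀ x y, f x * f y = f (x * y) * β.1 (E.π x) (E.π y) := hf
    have hβ : ∀ q, β.1 1 q = β.1 1 1 := fun q => by
      simpa using (cocycles_condition β 1 1 q).symm
    have hf1 : ∀ a g, f (E.ι a * g) = f (E.ι a) * (β.1 1 1)⁻¹ * f g := fun a g => by
      rw [mul_right_comm, hf, E.π_ι, hβ, mul_inv_cancel_right]
    -- By `hf1`, `a ↦ f (ι a) / β(1, 1)` is a homomorphism. Its inverse is taken because `f (sec x *
    -- sec y)` occurs in the denominator when `β` is expressed through `f`.
    let χ : A →* M := MonoidHom.mk' (fun a => β.1 1 1 * (f (E.ι a))⁻¹) (by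
      intro a b
      rw [map_mul, hf1]
      simp only [mul_inv, inv_inv, mul_assoc])
    refine ⟨χ, H2_mk_eq_iff.2 ⟨fun q => (f (E.sec q))⁻¹, fun x y => ?_⟩⟩
    have h1 := hf (E.sec x) (E.sec y)
    rw [E.π_sec, E.π_sec] at h1
    have h2 : E.sec x * E.sec y = E.ι (E.factorCocycle.1 x y) * E.sec (x * y) := by
      rw [ι_factorCocycle, inv_mul_cancel_right]
    rw [← mul_inv, h1, h2, hf1, traCocycle_apply]
    simp only [χ, MonoidHom.mk'_apply, mul_inv, inv_inv]
    rw [inv_mul_cancel_right]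
    ac_rfl
  · rintro ⟨χ, rfl⟩
    rw [H2Comap_mk, H2_mk_eq_one_iff]
    -- By `coord_mul`, the coordinate fails to be multiplicative exactly by the factor set, so `χ ∘
    -- coord` inverted bounds the inflated cocycle.
    refine ⟨fun g => (χ (E.coord g))⁻¹, fun x y => ?_⟩
    change _ = _ * χ (E.coord (E.sec (E.π x) * E.sec (E.π y)))
    dsimp only
    rw [E.coord_mul x, map_mul, map_mul, mul_inv, inv_mul_cancel_right, mul_inv]

/-- A section turns the extension into a product of sets. -/
noncomputable def equivProd : G ≃ A × Q where
  toFun g := (E.coord g, E.π g)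
  invFun p := E.ι p.1 * E.sec p.2
  left_inv := E.ι_coord_mul
  right_inv p := by
    dsimp only
    rw [E.coord_ι_mul, E.coord_sec, map_mul, E.π_ι, E.π_sec, mul_one, one_mul]

end Basic


/-! ### Splitting the twisted group algebra over the characters of the kernel -/

section Decomposition

open TwistedGroupAlgebra

variable {A Q G R : Type*} [CommGroup A] [Group Q] [Group G] [CommRing R]
  (E : CentralExtension A Q G)

/-- The algebra homomorphism `ḡ ↦ χ (coord g) • \overline{π g}` attached to a character `χ` of
the kernel. -/
noncomputable def toTwist (γ : cocycles Q Rˣ) (χ : A →* Rˣ) :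
    TwistedGroupAlgebra (cocyclesComap Rˣ E.π γ) →ₐ[R]
      TwistedGroupAlgebra (γ * E.traCocycle χ) :=
  lift _ (fun g => single _ (E.π g) (χ (E.coord g)))
    (by
      -- The section is not normalized, so `coord 1` need not be `1`; it is the inverse of the
      -- factor set at `(1, 1)`.
      have h : E.coord 1 = (E.coord (E.sec 1 * E.sec 1))⁻¹ := by
        have h1 := E.coord_mul 1 1
        rwa [mul_one, map_one, mul_assoc, left_eq_mul, mul_eq_one_iff_eq_inv] at h1
      rw [one_def, TwistedGroupAlgebra.smul_single]
      change _ = single _ 1 (((γ.1 (E.π 1) (E.π 1) : Rˣ) : R) *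
        ((γ.1 1 1 * χ (E.coord (E.sec 1 * E.sec 1)))⁻¹ : Rˣ))
      rw [map_one, ← Units.val_mul, mul_inv, mul_inv_cancel_left, h, map_inv])
    (by
      intro g h
      rw [single_mul_single, TwistedGroupAlgebra.smul_single, map_mul, E.coord_mul g h]
      congr 1
      change _ * (((γ.1 (E.π g) (E.π h)) * χ (E.coord (E.sec (E.π g) * E.sec (E.π h))) : Rˣ) : R)
        = ((γ.1 (E.π g) (E.π h) : Rˣ) : R) * _
      simp only [map_mul, Units.val_mul]
      ring)

/-- The coefficient at `q` is the Fourier transform over `A` of `x` restricted to the fibre above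
`q`, so Fourier uniqueness applies fibre by fibre. -/
lemma toTwist_apply [Fintype A] [Finite Q] (γ : cocycles Q Rˣ) (χ : A →* Rˣ) (x : G →₀ R)
    (q : Q) :
    (show Q →₀ R from E.toTwist γ χ (show TwistedGroupAlgebra _ from x)) q =
      ∑ a, x (E.ι a * E.sec q) * χ a := by
  classical
  have := Fintype.ofFinite Q
  have := Fintype.ofEquiv _ E.equivProd.symm
  change Finsupp.linearCombination R
    (fun g => (Finsupp.single (E.π g) (χ (E.coord g) : R) : Q →₀ R)) x q = _
  rw [Finsupp.linearCombination_apply, Finsupp.sum_fintype _ _ (by simp),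
    ← E.equivProd.symm.sum_comp, Fintype.sum_prod_type, Finsupp.finsetSum_apply]
  refine Finset.sum_congr rfl fun a _ => ?_
  rw [Finsupp.finsetSum_apply, Finset.sum_eq_single q]
  · simp [equivProd, E.coord_ι_mul, E.coord_sec, E.π_ι, E.π_sec]
  · intro p _ hp
    simp [equivProd, E.coord_ι_mul, E.coord_sec, E.π_ι, E.π_sec, hp]
  · simp

end Decomposition

/-- The characters of a finite abelian group determine a function on it. -/
lemma eq_zero_of_forall_sum_character_eq_zero {A : Type*} [CommGroup A] [Fintype A] (x : A → ℂ)
    (h : ∀ χ : A →* ℂˣ, ∑ a, x a * χ a = 0) : x = 0 := by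
  -- Characters separate the points of `A`, so evaluations at distinct points are distinct
  -- characters of the dual group, and these are linearly independent.
  have hinj : Function.Injective
      (fun a : A => (Units.coeHom ℂ).comp (MonoidHom.eval a : (A →* ℂˣ) →* ℂˣ)) := by
    intro a b hab
    by_contra hne
    obtain ⟨χ, hχ⟩ := CommGroup.exists_apply_ne_one_of_hasEnoughRootsOfUnity A ℂ
      (a := a * b⁻¹) (by rwa [Ne, mul_inv_eq_one])
    apply hχ
    have := DFunLike.congr_fun hab χ
    rw [map_mul, map_inv, mul_inv_eq_one]
    exact Units.ext this
  have hli := (linearIndependent_monoidHom (A →* ℂˣ) ℂ).comp _ hinj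
  rw [Fintype.linearIndependent_iff] at hli
  funext a
  refine hli x ?_ a
  funext χ
  simpa [Finset.sum_apply] using h χ

variable {A Q G : Type*} [CommGroup A] [Group Q] [Group G] (E : CentralExtension A Q G)

/-- The twisted group algebra of an inflated cocycle `γ` is the product, over the characters `χ`
of the kernel, of the twisted group algebras for `γ` times the transgression of `χ`. -/
lemma nonempty_algEquiv_pi [Finite A] [Finite Q] (γ : cocycles Q ℂˣ) :
    Nonempty (TwistedGroupAlgebra (cocyclesComap ℂˣ E.π γ) ≃ₐ[ℂ]
      ∀ χ : A →* ℂˣ, TwistedGroupAlgebra (γ * E.traCocycle χ)) := by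
  have := Fintype.ofFinite Q
  have := Fintype.ofFinite A
  have := Fintype.ofFinite (A →* ℂˣ)
  have := Fintype.ofEquiv _ E.equivProd.symm
  let F : TwistedGroupAlgebra (cocyclesComap ℂˣ E.π γ) →ₐ[ℂ]
      ∀ χ : A →* ℂˣ, TwistedGroupAlgebra (γ * E.traCocycle χ) :=
    AlgHom.pi fun χ => E.toTwist γ χ
  have hinj : Function.Injective F.toLinearMap := by
    rw [← LinearMap.ker_eq_bot, LinearMap.ker_eq_bot']
    intro x hx
    refine Finsupp.ext (f := (show G →₀ ℂ from x)) fun g => ?_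
    have h0 : (fun a => (show G →₀ ℂ from x) (E.ι a * E.sec (E.π g))) = 0 := by
      refine eq_zero_of_forall_sum_character_eq_zero _ fun χ => ?_
      rw [← E.toTwist_apply γ χ]
      have h1 : E.toTwist γ χ x = 0 := congrFun hx χ
      exact DFunLike.congr_fun (show (show Q →₀ ℂ from E.toTwist γ χ x) = 0 from h1) _
    have h2 := congrFun h0 (E.coord g)
    dsimp only at h2
    rw [E.ι_coord_mul] at h2
    exact h2
  have hG : Module.Finite ℂ (TwistedGroupAlgebra (cocyclesComap ℂˣ E.π γ)) :=
    inferInstanceAs (Module.Finite ℂ (G →₀ ℂ))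
  have hQ (χ : A →* ℂˣ) : Module.Finite ℂ (TwistedGroupAlgebra (γ * E.traCocycle χ)) :=
    inferInstanceAs (Module.Finite ℂ (Q →₀ ℂ))
  have hQf (χ : A →* ℂˣ) : Module.Free ℂ (TwistedGroupAlgebra (γ * E.traCocycle χ)) :=
    inferInstanceAs (Module.Free ℂ (Q →₀ ℂ))
  -- Both dimensions equal `|A| · |Q|`, since `A` has `|A|` complex characters; injectivity then
  -- gives bijectivity.
  have hdim : Module.finrank ℂ (TwistedGroupAlgebra (cocyclesComap ℂˣ E.π γ)) =
      Module.finrank ℂ (∀ χ : A →* ℂˣ, TwistedGroupAlgebra (γ * E.traCocycle χ)) := by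
    rw [Module.finrank_pi_fintype]
    have h1 : Module.finrank ℂ (TwistedGroupAlgebra (cocyclesComap ℂˣ E.π γ)) = Fintype.card G :=
      Module.finrank_finsupp_self ℂ
    have h2 (χ : A →* ℂˣ) : Module.finrank ℂ (TwistedGroupAlgebra (γ * E.traCocycle χ)) =
        Fintype.card Q := Module.finrank_finsupp_self ℂ
    have h3 := CommGroup.card_monoidHom_of_hasEnoughRootsOfUnity A ℂ
    rw [Nat.card_eq_fintype_card, Nat.card_eq_fintype_card] at h3
    simp only [h1, h2, Finset.sum_const, Finset.card_univ, smul_eq_mul, h3]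
    rw [Fintype.card_congr E.equivProd, Fintype.card_prod]
  exact ⟨AlgEquiv.ofBijective F
    ⟨hinj, (LinearMap.injective_iff_surjective_of_finrank_eq_finrank hdim).1 hinj⟩⟩

/-- Central extensions of the same quotient by the same kernel with equal transgressions and
surjective inflations have twisted group algebras that correspond to each other. -/
theorem twistedEquiv [Finite A] [Finite Q] {H : Type*} [Group H] (E' : CentralExtension A Q H)
    (hE : Function.Surjective (H2Comap ℂˣ E.π)) (hE' : Function.Surjective (H2Comap ℂˣ E'.π))
    (htra : ∀ χ : A →* ℂˣ, (E.traCocycle χ : H2 Q ℂˣ) = E'.traCocycle χ) :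
    TwistedEquiv ℂ G H := by
  have hker : (H2Comap ℂˣ E.π).ker = (H2Comap ℂˣ E'.π).ker := by
    ext x
    simp only [mem_ker_inflation_iff, htra]
  -- The isomorphism is the one characterized by `φ ∘ inf = inf'`.
  let φ := ((QuotientGroup.quotientKerEquivOfSurjective _ hE).symm.trans
    (QuotientGroup.quotientMulEquivOfEq hker)).trans
    (QuotientGroup.quotientKerEquivOfSurjective _ hE')
  have hφ (x : H2 Q ℂˣ) : φ (H2Comap ℂˣ E.π x) = H2Comap ℂˣ E'.π x := by
    have h : (QuotientGroup.quotientKerEquivOfSurjective _ hE).symm (H2Comap ℂˣ E.π x) =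
        (x : H2 Q ℂˣ ⧸ (H2Comap ℂˣ E.π).ker) := by
      rw [MulEquiv.symm_apply_eq]
      rfl
    simp only [φ, MulEquiv.trans_apply, h]
    rfl
  refine ⟨φ, fun α β hαβ => ?_⟩
  obtain ⟨x, hx⟩ := hE α
  induction x using QuotientGroup.induction_on with | H γ => ?_
  rw [← hx, hφ] at hαβ
  obtain ⟨e₁⟩ := TwistedGroupAlgebra.nonempty_algEquiv_of_mk_eq (R := ℂ) hx
  obtain ⟨e₂⟩ := TwistedGroupAlgebra.nonempty_algEquiv_of_mk_eq (R := ℂ) hαβ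
  obtain ⟨d₁⟩ := E.nonempty_algEquiv_pi γ
  obtain ⟨d₂⟩ := E'.nonempty_algEquiv_pi γ
  have hχ (χ : A →* ℂˣ) : ((γ * E.traCocycle χ : cocycles Q ℂˣ) : H2 Q ℂˣ) =
      ((γ * E'.traCocycle χ : cocycles Q ℂˣ) : H2 Q ℂˣ) := by
    rw [QuotientGroup.mk_mul, htra, QuotientGroup.mk_mul]
  let e χ := (TwistedGroupAlgebra.nonempty_algEquiv_of_mk_eq (R := ℂ) (hχ χ)).some
  exact ⟨e₁.symm.trans (d₁.trans ((AlgEquiv.piCongrRight e).trans (d₂.symm.trans e₂)))⟩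

end CentralExtension

/-! ### Cocycles of a direct product -/

section Product

open TwistedGroupAlgebra

variable {G₁ G₂ R : Type*} [Group G₁] [Group G₂] [CommRing R]

/-- The commutator pairing of a cocycle of a direct product. -/
def commutatorPairing (α : cocycles (G₁ × G₂) Rˣ) (x : G₁) (y : G₂) : Rˣ :=
  α.1 (x, 1) (1, y) * (α.1 (1, y) (x, 1))⁻¹

namespace TwistedGroupAlgebra

variable {G : Type*} [Group G] (α : cocycles G Rˣ)

lemma unit_smul_single_injective {g : G} {r s : Rˣ}
    (h : (r : R) • single α g (1 : R) = (s : R) • single α g 1) : r = s := by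
  rw [smul_single, smul_single, mul_one, mul_one] at h
  exact Units.ext (Finsupp.single_injective g h)

lemma single_one_mul_single_one (g h : G) :
    single α g 1 * single α h 1 = (α.1 g h : R) • single α (g * h) 1 := by
  rw [single_mul_single, smul_single, one_mul, one_mul, mul_one]

end TwistedGroupAlgebra

section

variable (α : cocycles (G₁ × G₂) Rˣ)

lemma single_inl_mul_single_inr (x : G₁) (y : G₂) :
    single α (x, 1) 1 * single α (1, y) 1 =
      (commutatorPairing α x y : R) • (single α (1, y) 1 * single α (x, 1) (1 : R)) := by
  rw [single_one_mul_single_one, single_one_mul_single_one, smul_smul, ← Units.val_mul,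
    commutatorPairing, inv_mul_cancel_right]
  simp

lemma single_inr_mul_single_inl (x : G₁) (y : G₂) :
    single α (1, y) 1 * single α (x, 1) 1 =
      (((commutatorPairing α x y)⁻¹ : Rˣ) : R) •
        (single α (x, 1) 1 * single α (1, y) (1 : R)) := by
  rw [single_inl_mul_single_inr, smul_smul, Units.inv_mul, one_smul]

/-- Lets the pairing be read off from commutation in the algebra, so that its identities follow from
associativity there. -/
lemma eq_commutatorPairing {x : G₁} {y : G₂} {r : Rˣ}
    (h : single α (x, 1) 1 * single α (1, y) 1 =
      (r : R) • (single α (1, y) 1 * single α (x, 1) (1 : R))) :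
    commutatorPairing α x y = r := by
  rw [single_inl_mul_single_inr, single_one_mul_single_one, smul_smul, smul_smul,
    ← Units.val_mul, ← Units.val_mul] at h
  exact mul_right_cancel (unit_smul_single_injective α h)

/-- Up to a scalar that cancels, the basis element of `x * x'` is the product of those of `x` and
`x'`; moving it past that of `y` takes two swaps. -/
lemma commutatorPairing_mul_left (x x' : G₁) (y : G₂) :
    commutatorPairing α (x * x') y = commutatorPairing α x y * commutatorPairing α x' y := by
  have hx : single α (x * x', 1) (1 : R) =
      (((α.1 (x, 1) (x', 1))⁻¹ : Rˣ) : R) • (single α (x, 1) 1 * single α (x', 1) 1) := by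
    rw [single_one_mul_single_one, smul_smul, Units.inv_mul, one_smul, Prod.mk_mul_mk, mul_one]
  refine eq_commutatorPairing α ?_
  rw [hx, smul_mul_assoc, mul_smul_comm, mul_assoc, single_inl_mul_single_inr, mul_smul_comm,
    ← mul_assoc, single_inl_mul_single_inr, smul_mul_assoc, mul_assoc]
  simp only [smul_smul, Units.val_mul]
  congr 1
  ring

lemma commutatorPairing_mul_right (x : G₁) (y y' : G₂) :
    commutatorPairing α x (y * y') = commutatorPairing α x y * commutatorPairing α x y' := by
  have hy : single α (1, y * y') (1 : R) =
      (((α.1 (1, y) (1, y'))⁻¹ : Rˣ) : R) • (single α (1, y) 1 * single α (1, y') 1) := by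
    rw [single_one_mul_single_one, smul_smul, Units.inv_mul, one_smul, Prod.mk_mul_mk, mul_one]
  refine eq_commutatorPairing α ?_
  rw [hy, smul_mul_assoc, mul_smul_comm, ← mul_assoc, single_inl_mul_single_inr, smul_mul_assoc,
    mul_assoc, single_inl_mul_single_inr, mul_smul_comm, mul_assoc]
  simp only [smul_smul, Units.val_mul]
  congr 1
  ring

/-- The commutator pairing as a bimultiplicative map. -/
def commutatorPairingHom : G₁ →* G₂ →* Rˣ :=
  MonoidHom.mk' (fun x => MonoidHom.mk' (commutatorPairing α x) (commutatorPairing_mul_right α x))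
    fun x x' => MonoidHom.ext fun y => commutatorPairing_mul_left α x x' y

end

/-- The 2-cocycle `(x, y) ↦ b y₁ x₂` of `G₁ × G₂` attached to a bimultiplicative map `b`. -/
def pairingCocycle {M : Type*} [CommGroup M] (b : G₁ →* G₂ →* M) : cocycles (G₁ × G₂) M :=
  ⟨fun x y => b y.1 x.2, by
    intro x y z
    simp only [Prod.fst_mul, Prod.snd_mul, map_mul, MonoidHom.mul_apply]
    rw [mul_left_comm (b z.1 y.2), mul_comm (b z.1 y.2)]⟩

/-- A cocycle of a direct product is cohomologous to the product of its restrictions to the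
factors and of a pairing. -/
lemma mk_eq_mul_pairing (α : cocycles (G₁ × G₂) Rˣ) :
    (α : H2 (G₁ × G₂) Rˣ) =
      H2Comap Rˣ (MonoidHom.fst G₁ G₂) (H2Comap Rˣ (MonoidHom.inl G₁ G₂) α) *
      H2Comap Rˣ (MonoidHom.snd G₁ G₂) (H2Comap Rˣ (MonoidHom.inr G₁ G₂) α) *
      (pairingCocycle (commutatorPairingHom α)⁻¹ : cocycles (G₁ × G₂) Rˣ) := by
  simp only [H2Comap_mk, ← QuotientGroup.mk_mul]
  rw [H2_mk_eq_iff]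
  refine ⟨fun x => α.1 (x.1, 1) (1, x.2), fun x y => ?_⟩
  change α.1 (x.1, 1) (1, x.2) * α.1 (y.1, 1) (1, y.2) * α.1 x y =
    α.1 (x.1 * y.1, 1) (1, x.2 * y.2) *
      (α.1 (x.1, 1) (y.1, 1) * α.1 (1, x.2) (1, y.2) * (commutatorPairing α y.1 x.2)⁻¹)
  -- The scalars `f z` rescale the basis to `u z`, the product of the basis elements of the two
  -- components of `z`. The identity comes from computing `u x * u y` in two ways; exchanging the
  -- middle factors produces the inverse pairing.
  have hu (z : G₁ × G₂) : single α (z.1, 1) (1 : R) * single α (1, z.2) 1 =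
      (α.1 (z.1, 1) (1, z.2) : R) • single α z 1 := by
    rw [single_one_mul_single_one]
    simp
  apply unit_smul_single_injective α (g := x * y)
  have h1 : ((α.1 (x.1, 1) (1, x.2) * α.1 (y.1, 1) (1, y.2) * α.1 x y : Rˣ) : R) •
      single α (x * y) (1 : R) =
      (single α (x.1, 1) (1 : R) * single α (1, x.2) 1) *
        (single α (y.1, 1) (1 : R) * single α (1, y.2) 1) := by
    rw [hu, hu, smul_mul_assoc, mul_smul_comm, single_one_mul_single_one, smul_smul, smul_smul]
    simp only [Units.val_mul]
  have h2 : (single α (x.1, 1) (1 : R) * single α (1, x.2) 1) *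
        (single α (y.1, 1) (1 : R) * single α (1, y.2) 1) =
      (((commutatorPairing α y.1 x.2)⁻¹ : Rˣ) : R) •
        ((single α (x.1, 1) (1 : R) * single α (y.1, 1) 1) *
        (single α (1, x.2) (1 : R) * single α (1, y.2) 1)) := by
    rw [mul_assoc, ← mul_assoc (single α (1, x.2) 1), single_inr_mul_single_inl]
    simp only [smul_mul_assoc, mul_smul_comm, mul_assoc]
  have h3 := hu (x * y)
  rw [h1, h2, single_one_mul_single_one, single_one_mul_single_one, smul_mul_assoc,
    mul_smul_comm, Prod.mk_mul_mk, Prod.mk_mul_mk, mul_one, mul_one]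
  rw [Prod.fst_mul, Prod.snd_mul] at h3
  rw [h3]
  simp only [smul_smul, Units.val_mul]
  congr 1
  ring

end Product

/-! ### Products of central extensions and extensions from central subgroups -/

namespace CentralExtension

section

variable {A Q G M : Type*} [CommGroup A] [Group Q] [Group G] [CommGroup M]
  (E : CentralExtension A Q G)

/-- A homomorphism that is trivial on the kernel descends to the quotient. -/
def descend (f : G →* M) (hf : ∀ a, f (E.ι a) = 1) : Q →* M :=
  MonoidHom.mk' (fun q => f (E.sec q)) fun x y => by
    have h := congrArg f (E.ι_factorCocycle x y)
    rw [hf, map_mul, map_mul, map_inv, eq_comm, mul_inv_eq_one] at h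
    exact h.symm

lemma descend_π (f : G →* M) (hf : ∀ a, f (E.ι a) = 1) (g : G) :
    E.descend f hf (E.π g) = f g := by
  change f (E.sec (E.π g)) = f g
  conv_rhs => rw [← E.ι_coord_mul g, map_mul, hf, one_mul]

end

variable {A₁ Q₁ G₁ A₂ Q₂ G₂ : Type*} [CommGroup A₁] [Group Q₁] [Group G₁]
  [CommGroup A₂] [Group Q₂] [Group G₂]
  (E₁ : CentralExtension A₁ Q₁ G₁) (E₂ : CentralExtension A₂ Q₂ G₂)

/-- The direct product of two central extensions. -/
def prod : CentralExtension (A₁ × A₂) (Q₁ × Q₂) (G₁ × G₂) where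
  ι := E₁.ι.prodMap E₂.ι
  π := E₁.π.prodMap E₂.π
  sec q := (E₁.sec q.1, E₂.sec q.2)
  ι_injective := E₁.ι_injective.prodMap E₂.ι_injective
  π_ι a := Prod.ext (E₁.π_ι a.1) (E₂.π_ι a.2)
  exists_ι_eq g hg := by
    obtain ⟨a, ha⟩ := E₁.exists_ι_eq g.1 (congrArg Prod.fst hg)
    obtain ⟨b, hb⟩ := E₂.exists_ι_eq g.2 (congrArg Prod.snd hg)
    exact ⟨(a, b), Prod.ext ha hb⟩
  central a g := Prod.ext (E₁.central a.1 g.1) (E₂.central a.2 g.2)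
  π_sec q := Prod.ext (E₁.π_sec q.1) (E₂.π_sec q.2)

lemma prod_factorCocycle (x y : Q₁ × Q₂) :
    (E₁.prod E₂).factorCocycle.1 x y =
      (E₁.factorCocycle.1 x.1 y.1, E₂.factorCocycle.1 x.2 y.2) := by
  apply (E₁.prod E₂).ι_injective
  rw [ι_factorCocycle]
  exact Prod.ext (E₁.ι_factorCocycle x.1 y.1).symm (E₂.ι_factorCocycle x.2 y.2).symm

lemma prod_traCocycle {M : Type*} [CommGroup M] (χ : A₁ × A₂ →* M) :
    ((E₁.prod E₂).traCocycle χ : H2 (Q₁ × Q₂) M) =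
      H2Comap M (MonoidHom.fst Q₁ Q₂) (E₁.traCocycle (χ.comp (MonoidHom.inl A₁ A₂))) *
      H2Comap M (MonoidHom.snd Q₁ Q₂) (E₂.traCocycle (χ.comp (MonoidHom.inr A₁ A₂))) := by
  rw [H2Comap_mk, H2Comap_mk, ← QuotientGroup.mk_mul]
  congr 1
  ext x y
  change χ ((E₁.prod E₂).factorCocycle.1 x y) =
    χ (E₁.factorCocycle.1 x.1 y.1, 1) * χ (1, E₂.factorCocycle.1 x.2 y.2)
  rw [prod_factorCocycle, ← map_mul, Prod.mk_mul_mk, mul_one, one_mul]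

/-- If the characters of both groups are trivial on the kernels and both inflations are
surjective, then the inflation of the product extension is surjective. -/
lemma prod_inflation_surjective {R : Type*} [CommRing R]
    (h₁ : ∀ (ψ : G₁ →* Rˣ) (a : A₁), ψ (E₁.ι a) = 1)
    (h₂ : ∀ (ψ : G₂ →* Rˣ) (a : A₂), ψ (E₂.ι a) = 1)
    (hE₁ : Function.Surjective (H2Comap Rˣ E₁.π))
    (hE₂ : Function.Surjective (H2Comap Rˣ E₂.π)) :
    Function.Surjective (H2Comap Rˣ (E₁.prod E₂).π) := by
  intro x
  induction x using QuotientGroup.induction_on with | H α => ?_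
  obtain ⟨x₁, hx₁⟩ := hE₁ (H2Comap Rˣ (MonoidHom.inl G₁ G₂) α)
  obtain ⟨x₂, hx₂⟩ := hE₂ (H2Comap Rˣ (MonoidHom.inr G₁ G₂) α)
  let c := (commutatorPairingHom α)⁻¹
  -- Each `c g` is a character of `G₂`, hence trivial on `A₂`. Then, for fixed `q`, the values form
  -- a character of `G₁`, hence trivial on `A₁`, and `b` descends in both variables.
  let c' : G₁ →* Q₂ →* Rˣ := MonoidHom.mk' (fun g => E₂.descend (c g) (h₂ (c g)))
    fun g g' => MonoidHom.ext fun q => by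
      change c (g * g') (E₂.sec q) = c g (E₂.sec q) * c g' (E₂.sec q)
      rw [map_mul, MonoidHom.mul_apply]
  let b : Q₁ →* Q₂ →* Rˣ := E₁.descend c' fun a => MonoidHom.ext fun q =>
    h₁ (c.flip (E₂.sec q)) a
  have hb (g : G₁) (g' : G₂) : b (E₁.π g) (E₂.π g') = c g g' := by
    rw [show b (E₁.π g) = c' g from E₁.descend_π _ _ g]
    exact E₂.descend_π _ (h₂ (c g)) g'
  refine ⟨H2Comap Rˣ (MonoidHom.fst Q₁ Q₂) x₁ * H2Comap Rˣ (MonoidHom.snd Q₁ Q₂) x₂ *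
    (pairingCocycle b : cocycles (Q₁ × Q₂) Rˣ), ?_⟩
  rw [map_mul, map_mul, mk_eq_mul_pairing α, ← hx₁, ← hx₂]
  simp only [H2Comap_comp]
  congr 1
  rw [H2Comap_mk]
  congr 1
  ext x y
  exact congrArg Units.val (hb y.1 x.2)

/-- The extension with trivial kernel. -/
def trivial (G : Type*) [Group G] : CentralExtension Unit G G where
  ι := 1
  π := MonoidHom.id G
  sec := id
  ι_injective := Function.injective_of_subsingleton _
  π_ι _ := rfl
  exists_ι_eq g hg := ⟨(), Eq.symm hg⟩
  central a g := by simp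
  π_sec _ := rfl

/-- The central extension attached to a central subgroup, with kernel and quotient replaced by
isomorphic groups. -/
noncomputable def ofSubgroup {G A Q : Type*} [Group G] [CommGroup A] [Group Q] {Z : Subgroup G}
    [Z.Normal] (hZ : Z ≤ Subgroup.center G) (i : Z ≃* A) (φ : G ⧸ Z ≃* Q) :
    CentralExtension A Q G where
  ι := Z.subtype.comp i.symm.toMonoidHom
  π := φ.toMonoidHom.comp (QuotientGroup.mk' Z)
  sec q := (φ.symm q).out
  ι_injective := Z.subtype_injective.comp i.symm.injective
  π_ι a := by simp
  exists_ι_eq g hg := by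
    have h : (g : G ⧸ Z) = 1 := φ.map_eq_one_iff.1 hg
    exact ⟨i ⟨g, (QuotientGroup.eq_one_iff g).1 h⟩, by simp⟩
  central a g := (Subgroup.mem_center_iff.1 (hZ (i.symm a).2) g).symm
  π_sec q := by
    change φ (QuotientGroup.mk (φ.symm q).out) = q
    rw [QuotientGroup.out_eq', MulEquiv.apply_symm_apply]

section OfSubgroup

variable {G A Q M : Type*} [Group G] [CommGroup A] [Group Q] [CommGroup M] {Z : Subgroup G}
  [Z.Normal] (hZ : Z ≤ Subgroup.center G) (i : Z ≃* A) (φ : G ⧸ Z ≃* Q)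

lemma H2Comap_traCocycle_ofSubgroup (χ : A →* M) :
    H2Comap M φ.toMonoidHom ((ofSubgroup hZ i φ).traCocycle χ : H2 Q M) =
      transgression M hZ (χ.comp i.toMonoidHom) := by
  rw [H2Comap_mk]
  change _ = ((transgressionCocycle hZ Quotient.out Quotient.out_eq' (χ.comp i.toMonoidHom) :
    cocycles (G ⧸ Z) M) : H2 (G ⧸ Z) M)
  congr 1
  ext x y
  change χ ((ofSubgroup hZ i φ).factorCocycle.1 (φ x) (φ y)) =
    χ (i (factorSet Quotient.out Quotient.out_eq' x y))
  congr 1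
  apply (ofSubgroup hZ i φ).ι_injective
  rw [ι_factorCocycle]
  simp [ofSubgroup, factorSet, ← map_mul]

lemma ofSubgroup_inflation_surjective (h : Function.Surjective (inflation M Z)) :
    Function.Surjective (H2Comap M (ofSubgroup hZ i φ).π) := by
  intro x
  obtain ⟨y, rfl⟩ := h x
  refine ⟨H2Comap M φ.symm.toMonoidHom y, ?_⟩
  rw [H2Comap_comp, inflation]
  congr 2
  ext g
  exact φ.symm_apply_apply _

/-- If the transgression is injective, then the characters of the group are trivial on the central
subgroup. -/
lemma apply_ι_ofSubgroup_eq_one (h : Function.Injective (transgression M hZ)) (ψ : G →* M)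
    (a : A) : ψ ((ofSubgroup hZ i φ).ι a) = 1 := by
  have h1 : transgression M hZ (ψ.comp Z.subtype) = 1 := by
    change ((transgressionCocycle hZ Quotient.out Quotient.out_eq' (ψ.comp Z.subtype) :
      cocycles (G ⧸ Z) M) : H2 (G ⧸ Z) M) = 1
    rw [H2_mk_eq_one_iff]
    -- As `ψ` is defined on all of `G`, applying it to the section bounds `ψ` of the factor set.
    refine ⟨fun q => ψ q.out, fun x y => ?_⟩
    change _ = _ * ψ (x.out * y.out * (x * y).out⁻¹)
    rw [map_mul, map_mul, map_inv, mul_comm (ψ (x * y).out), inv_mul_cancel_right]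
  have h2 : ψ.comp Z.subtype = 1 := h (h1.trans (map_one _).symm)
  exact DFunLike.congr_fun h2 (i.symm a)

end OfSubgroup

end CentralExtension

/-! ### Compatible pairs of extensions -/

/-- Two central extensions of a group by the same kernel, with equal transgressions, surjective
inflations, and such that the characters of both groups are trivial on the kernel. -/
structure CentralExtension.Compatible {A Q G H : Type*} [CommGroup A] [Group Q] [Group G]
    [Group H] (E : CentralExtension A Q G) (E' : CentralExtension A Q H) : Prop where
  tra_eq : ∀ χ : A →* ℂˣ, (E.traCocycle χ : H2 Q ℂˣ) = E'.traCocycle χ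
  inf_left : Function.Surjective (H2Comap ℂˣ E.π)
  inf_right : Function.Surjective (H2Comap ℂˣ E'.π)
  char_left : ∀ (ψ : G →* ℂˣ) (a : A), ψ (E.ι a) = 1
  char_right : ∀ (ψ : H →* ℂˣ) (a : A), ψ (E'.ι a) = 1

lemma CentralExtension.Compatible.trivial (G : Type*) [Group G] :
    (CentralExtension.trivial G).Compatible (CentralExtension.trivial G) where
  tra_eq _ := rfl
  inf_left x := ⟨x, H2Comap_id x⟩
  inf_right x := ⟨x, H2Comap_id x⟩
  char_left ψ _ := map_one ψ
  char_right ψ _ := map_one ψ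

/-- Compatible central extensions of finite groups give equivalent direct products. -/
lemma CentralExtension.Compatible.twistedEquiv_prod
    {A₁ Q₁ G₁ H₁ A₂ Q₂ G₂ H₂ : Type*} [CommGroup A₁] [Group Q₁] [Group G₁] [Group H₁]
    [CommGroup A₂] [Group Q₂] [Group G₂] [Group H₂] [Finite G₁] [Finite G₂]
    {E₁ : CentralExtension A₁ Q₁ G₁} {E₁' : CentralExtension A₁ Q₁ H₁}
    {E₂ : CentralExtension A₂ Q₂ G₂} {E₂' : CentralExtension A₂ Q₂ H₂}
    (h₁ : E₁.Compatible E₁') (h₂ : E₂.Compatible E₂') :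
    TwistedEquiv ℂ (G₁ × G₂) (H₁ × H₂) := by
  have := Finite.of_injective _ (E₁.prod E₂).ι_injective
  have : Finite (Q₁ × Q₂) :=
    Finite.of_surjective (E₁.prod E₂).π fun q => ⟨_, (E₁.prod E₂).π_sec q⟩
  refine (E₁.prod E₂).twistedEquiv (E₁'.prod E₂')
    (E₁.prod_inflation_surjective E₂ h₁.char_left h₂.char_left h₁.inf_left h₂.inf_left)
    (E₁'.prod_inflation_surjective E₂' h₁.char_right h₂.char_right h₁.inf_right h₂.inf_right)
    fun χ => ?_
  rw [prod_traCocycle, prod_traCocycle, h₁.tra_eq, h₂.tra_eq]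

universe u v

/-- Both groups become extensions of `G ⧸ Z` by `Z`, the one for `H` being relabelled along `i` and
`φ`; the commuting square then says that the transgressions coincide. -/
lemma CompatibleCentralQuotients.exists_compatible {G : Type u} {H : Type v} [Group G] [Group H]
    (h : CompatibleCentralQuotients G H) :
    ∃ (A Q : Type u) (_ : CommGroup A) (_ : Group Q) (E : CentralExtension A Q G)
      (E' : CentralExtension A Q H), E.Compatible E' := by
  obtain ⟨Z, W, _, _, hZ, hW, ⟨hZi, -, hZs⟩, ⟨hWi, -, hWs⟩, i, φ, hφ⟩ := h
  let _ : CommGroup Z :=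
    { (inferInstance : Group Z) with
      mul_comm := fun a b => Subtype.ext (Subgroup.mem_center_iff.1 (hZ b.2) a) }
  refine ⟨Z, G ⧸ Z, inferInstance, inferInstance,
    CentralExtension.ofSubgroup hZ (MulEquiv.refl Z) (MulEquiv.refl _),
    CentralExtension.ofSubgroup hW i φ, fun χ => ?_,
    CentralExtension.ofSubgroup_inflation_surjective hZ _ _ hZs,
    CentralExtension.ofSubgroup_inflation_surjective hW _ _ hWs,
    CentralExtension.apply_ι_ofSubgroup_eq_one hZ _ _ hZi,
    CentralExtension.apply_ι_ofSubgroup_eq_one hW _ _ hWi⟩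
  -- Pullback along `φ` is injective, so the transgressions may be compared in `H²(H ⧸ W, ℂˣ)`,
  -- where `hφ` lives.
  have hinj : Function.Injective (H2Comap ℂˣ φ.toMonoidHom) := by
    refine Function.LeftInverse.injective (g := H2Comap ℂˣ φ.symm.toMonoidHom) fun x => ?_
    rw [H2Comap_comp]
    convert H2Comap_id x
    ext q
    exact φ.apply_symm_apply q
  apply hinj
  rw [CentralExtension.H2Comap_traCocycle_ofSubgroup hW i φ, ← hφ]
  congr 1
  rw [← H2Comap_id ((CentralExtension.traCocycle _ χ : cocycles (G ⧸ Z) ℂˣ) : H2 (G ⧸ Z) ℂˣ)]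
  exact CentralExtension.H2Comap_traCocycle_ofSubgroup hZ (MulEquiv.refl Z) (MulEquiv.refl _) χ

end TwistedGroupRing

theorem corollary1p4
    {G₁ G₂ H₁ H₂ : Type*} [Group G₁] [Group G₂] [Group H₁] [Group H₂]
    [Finite G₁] [Finite G₂] [Finite H₁] [Finite H₂]
    (h₁ : TwistedGroupRing.CompatibleCentralQuotients G₁ H₁)
    (h₂ : TwistedGroupRing.CompatibleCentralQuotients G₂ H₂) :
    TwistedGroupRing.TwistedEquiv ℂ (G₁ × G₂) (H₁ × H₂) ∧
      ∀ (A : Type*) [CommGroup A] [Finite A],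
        TwistedGroupRing.TwistedEquiv ℂ (G₁ × A) (H₁ × A) := by
  obtain ⟨A₁, Q₁, _, _, E₁, E₁', hE₁⟩ := h₁.exists_compatible
  obtain ⟨A₂, Q₂, _, _, E₂, E₂', hE₂⟩ := h₂.exists_compatible
  exact ⟨hE₁.twistedEquiv_prod hE₂, fun A _ _ =>
    hE₁.twistedEquiv_prod (TwistedGroupRing.CentralExtension.Compatible.trivial A)⟩
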